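/- Let $m\ge 1$ and $0\le k\le 2m-1$. There is a constant $K>0$, depending only on $m$ and $k$, such that for all pairwise distinct real nodes $t_1,\dots,t_m$ there is an $\varepsilon_0>0$ with the following property. Let $D=\operatorname{diag}(t_1,\dots,t_m)$, let $$\mathbf C=\begin{bmatrix} D&O\\ I&D\end{bmatrix}\in\mathbb R^{2m\times 2m},\qquad \mathbf b=\begin{bmatrix}\mathbf e_m\\ \mathbf 0_m\end{bmatrix}\in\mathbb R^{2m},$$ where $\mathbf e_m=(1,\dots,1)^T$, and let $0\le\varepsilon_{\rm mach}\le\varepsilon_0$. Run $k$ steps of the Arnoldi process for $\mathbf C$ with starting vector $\mathbf b$, orthogonalizing each new vector by modified Gram--Schmidt and reorthogonalizing it by a second modified Gram--Schmidt pass, in any floating-point arithmetic that obeys the standard model with unit roundoff $\varepsilon_{\rm mach}$ (every computed sum, difference, product, quotient and square root $z$ has the form $\hat z=z(1+\delta)$ with $|\delta|\le\varepsilon_{\rm mach}$; no overflow or underflow); $\varepsilon_{\rm mach}=0$ is exact arithmetic. Then the process does not break down (no computed normalization factor is zero), the computed basis matrix $\mathcal Q=\begin{bmatrix}Q_f\\Q_d\end{bmatrix}\in\mathbb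 R^{2m\times(k+1)}$ has linearly independent columns, and its spectral condition number $\kappa_2(\mathcal Q)=\sigma_{\max}(\mathcal Q)/\sigma_{\min}(\mathcal Q)$ satisfies $$|\kappa_2(\mathcal Q)-1|\le K\,\varepsilon_{\rm mach},$$ that is, $\kappa_2(\mathcal Q)=1+\mathcal O(\varepsilon_{\rm mach})$, with a constant that does not depend on the nodes. -/

import Mathlib

noncomputable section

namespace CVA

/-! ### Floating-point arithmetic -/

/-- A floating-point arithmetic with unit roundoff `u`, in the standard model: every basic operation
returns the exact result up to a relative error of at most `u` (no overflow or underflow). -/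
structure FloatArith (u : ℝ) where
  add : ℝ → ℝ → ℝ
  sub : ℝ → ℝ → ℝ
  mul : ℝ → ℝ → ℝ
  div : ℝ → ℝ → ℝ
  sqrt : ℝ → ℝ
  add_err : ∀ x y, |add x y - (x + y)| ≤ u * |x + y|
  sub_err : ∀ x y, |sub x y - (x - y)| ≤ u * |x - y|
  mul_err : ∀ x y, |mul x y - x * y| ≤ u * |x * y|
  div_err : ∀ x y, y ≠ 0 → |div x y - x / y| ≤ u * |x / y|
  sqrt_err : ∀ x, 0 ≤ x → |sqrt x - Real.sqrt x| ≤ u * |Real.sqrt x|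

/-- Rounding to a nearest floating-point number with base `β` and `p` significant digits
(unbounded exponent range). -/
def roundNearest (β p : ℕ) (x : ℝ) : ℝ :=
  (round (x / (β : ℝ) ^ (Int.log β |x| + 1 - (p : ℤ))) : ℝ) *
    (β : ℝ) ^ (Int.log β |x| + 1 - (p : ℤ))

theorem roundNearest_err (β p : ℕ) (hβ : 2 ≤ β) (x : ℝ) :
    |roundNearest β p x - x| ≤ ((β : ℝ) ^ (1 - (p : ℤ)) / 2) * |x| := by
  have hβ0 : (0 : ℝ) < β := by exact_mod_cast (by omega : 0 < β)
  rcases eq_or_ne x 0 with rfl | hx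
  · simp [roundNearest]
  set s : ℝ := (β : ℝ) ^ (Int.log β |x| + 1 - (p : ℤ)) with hs
  have hs0 : 0 < s := zpow_pos hβ0 _
  have h1 : roundNearest β p x - x = -((x / s - round (x / s)) * s) := by
    simp only [roundNearest, ← hs]
    field_simp
    ring
  have h2 : |x / s - round (x / s)| ≤ 1 / 2 := abs_sub_round _
  have h3 : (β : ℝ) ^ (Int.log β |x|) ≤ |x| :=
    Int.zpow_log_le_self (by omega) (abs_pos.mpr hx)
  have h4 : s = (β : ℝ) ^ (1 - (p : ℤ)) * (β : ℝ) ^ (Int.log β |x|) := by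
    rw [hs, ← zpow_add₀ hβ0.ne']
    congr 1
    ring
  rw [h1, abs_neg, abs_mul, abs_of_pos hs0]
  calc |x / s - round (x / s)| * s ≤ 1 / 2 * s := by gcongr
    _ = (β : ℝ) ^ (1 - (p : ℤ)) / 2 * (β : ℝ) ^ (Int.log β |x|) := by rw [h4]; ring
    _ ≤ _ := by gcongr

/-- The correctly rounded arithmetic with base `β` and `p` digits; its unit roundoff is
`β ^ (1 - p) / 2`. -/
def FloatArith.nearest (β p : ℕ) (hβ : 2 ≤ β) : FloatArith ((β : ℝ) ^ (1 - (p : ℤ)) / 2) where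
  add x y := roundNearest β p (x + y)
  sub x y := roundNearest β p (x - y)
  mul x y := roundNearest β p (x * y)
  div x y := roundNearest β p (x / y)
  sqrt x := roundNearest β p (Real.sqrt x)
  add_err _ _ := roundNearest_err β p hβ _
  sub_err _ _ := roundNearest_err β p hβ _
  mul_err _ _ := roundNearest_err β p hβ _
  div_err _ _ _ := roundNearest_err β p hβ _
  sqrt_err _ _ := roundNearest_err β p hβ _

/-! ### Vectors of length `2m`, computed in floating-point arithmetic -/

/-- Row indices of `ℝ^{2m}`: first the `m` function rows, then the `m` derivative rows. -/
abbrev Idx (m : ℕ) : Type := Fin m ⊕ Fin m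

/-- The rows in their natural order. -/
def rows (m : ℕ) : List (Idx m) :=
  (List.finRange m).map Sum.inl ++ (List.finRange m).map Sum.inr

variable {u : ℝ} (F : FloatArith u) {m : ℕ}

/-- Inner product, computed by recursive summation. -/
def flDot (x y : Idx m → ℝ) : ℝ :=
  (rows m).foldl (fun s i => F.add s (F.mul (x i) (y i))) 0

/-- Computed matrix-vector product. -/
def flMulVec (A : Matrix (Idx m) (Idx m) ℝ) (x : Idx m → ℝ) : Idx m → ℝ :=
  fun i => flDot F (A i) x

/-- Computed Euclidean norm. -/
def flNorm (x : Idx m → ℝ) : ℝ := F.sqrt (flDot F x x)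

/-- Computed normalization. -/
def flNormalize (x : Idx m → ℝ) : Idx m → ℝ := fun i => F.div (x i) (flNorm F x)

/-- One pass of modified Gram-Schmidt: for each `q` of the list in turn, compute `h = qᵀ w` and
replace `w` by `w - h q`. -/
def mgsPass (Q : List (Idx m → ℝ)) (w : Idx m → ℝ) : Idx m → ℝ :=
  Q.foldl (fun w q => fun i => F.sub (w i) (F.mul (flDot F q w) (q i))) w

/-! ### The Arnoldi process with reorthogonalization -/

/-- The new direction of an Arnoldi step, before normalization: `A q` is orthogonalized against
the basis `Q` by modified Gram-Schmidt, and then reorthogonalized by a second pass. -/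
def arnoldiDir (A : Matrix (Idx m) (Idx m) ℝ) (Q : List (Idx m → ℝ)) (q : Idx m → ℝ) :
    Idx m → ℝ :=
  mgsPass F Q (mgsPass F Q (flMulVec F A q))

/-- The computed Arnoldi vectors `q_0, q_1, …` of `A` for the starting vector `b`. -/
def arnoldiVec (A : Matrix (Idx m) (Idx m) ℝ) (b : Idx m → ℝ) : ℕ → (Idx m → ℝ)
  | 0 => flNormalize F b
  | j + 1 => flNormalize F
      (arnoldiDir F A (List.ofFn fun i : Fin (j + 1) => arnoldiVec A b i.1) (arnoldiVec A b j))
  termination_by j => j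

/-- The computed subdiagonal Hessenberg entry `h_{j+1,j}`, the number by which step `j` divides. -/
def arnoldiSubdiag (A : Matrix (Idx m) (Idx m) ℝ) (b : Idx m → ℝ) (j : ℕ) : ℝ :=
  flNorm F
    (arnoldiDir F A (List.ofFn fun i : Fin (j + 1) => arnoldiVec F A b i.1) (arnoldiVec F A b j))

/-- The computed basis matrix with columns `q_0, …, q_k`. -/
def arnoldiBasis (A : Matrix (Idx m) (Idx m) ℝ) (b : Idx m → ℝ) (k : ℕ) :
    Matrix (Idx m) (Fin (k + 1)) ℝ :=
  Matrix.of fun i j => arnoldiVec F A b j.1 i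

/-! ### The confluent operator and the condition number -/

/-- The augmented confluent operator `[[D, 0], [I, D]]` with `D = diag(t_1, …, t_m)`. -/
def confluentOp (t : Fin m → ℝ) : Matrix (Idx m) (Idx m) ℝ :=
  Matrix.fromBlocks (Matrix.diagonal t) 0 1 (Matrix.diagonal t)

/-- The starting vector `[e; 0]`. -/
def startVec (m : ℕ) : Idx m → ℝ := Sum.elim (fun _ => 1) (fun _ => 0)

/-- The spectral condition number `σ_max / σ_min` of a matrix with linearly independent columns:
the ratio of the largest to the least value of `‖A x‖₂` over the unit vectors `x`. -/
def cond₂ {ι κ : Type*} [Fintype ι] [Fintype κ] (A : Matrix ι κ ℝ) : ℝ :=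
  (⨆ x : Metric.sphere (0 : EuclideanSpace ℝ κ) 1,
      ‖WithLp.toLp 2 (Matrix.mulVec A (WithLp.ofLp x.1))‖) /
    (⨅ x : Metric.sphere (0 : EuclideanSpace ℝ κ) 1,
      ‖WithLp.toLp 2 (Matrix.mulVec A (WithLp.ofLp x.1))‖)

end CVA

end

/-! Two estimates of different nature are kept apart: a qualitative one that fixes ε₀ and may depend
on the nodes, and a quantitative one that fixes the constant and may not.

Qualitative: the exact Arnoldi vector of index j lists the values and derivatives of a polynomial of
degree exactly j (`exists_arnoldiVec_exact_eq_hermiteVec`). For j < 2m it is nonzero, because m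
double roots are too many (`hermiteVec_ne_zero`). So the exact process never divides by zero, and
the computed vectors converge to the exact ones as the roundoff tends to zero
(`tendsto_arnoldiVec`).

Quantitative: a Gram-Schmidt pass against a nearly orthonormal basis leaves components of size O(ε)
relative to its input (`exists_abs_dotProduct_mgs_le`). After heavy cancellation this says little
about the normalized output. The second pass cures this: in exact arithmetic it changes nothing, so
for small ε its input is less than twice its output (`eventually_norm_mgs_le`), and the
node-dependent cancellation drops out. By induction the Gram matrix is I + O(ε) with a constant free
of the nodes (`exists_eventually_nearOrthonormal`), which puts κ₂ within O(ε) of 1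
(`abs_cond₂_sub_one_le`). -/

namespace CVA

open Filter Topology Polynomial

/-! ### Exact arithmetic: Arnoldi vectors as Hermite data of polynomials. -/

section Exact

/-- Exact real arithmetic. -/
noncomputable def FloatArith.exact : FloatArith 0 where
  add x y := x + y
  sub x y := x - y
  mul x y := x * y
  div x y := x / y
  sqrt x := Real.sqrt x
  add_err _ _ := by simp
  sub_err _ _ := by simp
  mul_err _ _ := by simp
  div_err _ _ _ := by simp
  sqrt_err _ _ := by simp

variable {m : ℕ} {u : ℝ}

theorem sum_map_rows (f : Idx m → ℝ) : ((rows m).map f).sum = ∑ i, f i := by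
  simp [rows, Fintype.sum_sum_type, Fin.sum_univ_def, Function.comp_def]

theorem flDot_exact (x y : Idx m → ℝ) : flDot FloatArith.exact x y = x ⬝ᵥ y := by
  have key : ∀ (l : List (Idx m)) (s : ℝ),
      l.foldl (fun s i => FloatArith.exact.add s (FloatArith.exact.mul (x i) (y i))) s =
        s + (l.map fun i => x i * y i).sum := by
    intro l
    induction l with
    | nil => simp
    | cons a l ih =>
      intro s
      rw [List.foldl_cons, ih, List.map_cons, List.sum_cons, ← add_assoc]
      rfl
  rw [flDot, key, sum_map_rows, zero_add]
  rfl

theorem flMulVec_exact (A : Matrix (Idx m) (Idx m) ℝ) (x : Idx m → ℝ) :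
    flMulVec FloatArith.exact A x = A.mulVec x := by
  ext i
  simp [flMulVec, flDot_exact, Matrix.mulVec]

theorem flNorm_exact (x : Idx m → ℝ) : flNorm FloatArith.exact x = √(x ⬝ᵥ x) := by
  rw [flNorm, flDot_exact]
  rfl

theorem flNormalize_exact (x : Idx m → ℝ) :
    flNormalize FloatArith.exact x = (√(x ⬝ᵥ x))⁻¹ • x := by
  ext i
  rw [Pi.smul_apply, smul_eq_mul, inv_mul_eq_div, ← flNorm_exact]
  rfl

/-- One step of modified Gram-Schmidt. -/
def mgsStep (F : FloatArith u) (q w : Idx m → ℝ) : Idx m → ℝ :=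
  fun i => F.sub (w i) (F.mul (flDot F q w) (q i))

theorem mgsStep_exact (q w : Idx m → ℝ) :
    mgsStep FloatArith.exact q w = w - (q ⬝ᵥ w) • q := by
  ext i
  rw [mgsStep, flDot_exact]
  rfl

/-- Modified Gram-Schmidt against the first `n` vectors of a sequence. -/
def mgs (F : FloatArith u) (v : ℕ → Idx m → ℝ) (n : ℕ) (w : Idx m → ℝ) : Idx m → ℝ :=
  mgsPass F ((List.range n).map v) w

@[simp]
theorem mgs_zero (F : FloatArith u) (v : ℕ → Idx m → ℝ) (w : Idx m → ℝ) : mgs F v 0 w = w := rfl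

theorem mgs_succ (F : FloatArith u) (v : ℕ → Idx m → ℝ) (n : ℕ) (w : Idx m → ℝ) :
    mgs F v (n + 1) w = mgsStep F (v n) (mgs F v n w) := by
  simp only [mgs, mgsPass, List.range_succ, List.map_append, List.foldl_append, List.map_cons,
    List.map_nil, List.foldl_cons, List.foldl_nil]
  rfl

/-- The Arnoldi vector of index `j + 1` before its normalization. -/
def arnoldiNext (F : FloatArith u) (A : Matrix (Idx m) (Idx m) ℝ) (b : Idx m → ℝ) (j : ℕ) :
    Idx m → ℝ :=
  mgs F (arnoldiVec F A b) (j + 1)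
    (mgs F (arnoldiVec F A b) (j + 1) (flMulVec F A (arnoldiVec F A b j)))

theorem ofFn_val_eq_map_range {α : Type*} (v : ℕ → α) (n : ℕ) :
    (List.ofFn fun i : Fin n => v i.1) = (List.range n).map v := by
  apply List.ext_getElem <;> simp

theorem arnoldiVec_zero (F : FloatArith u) (A : Matrix (Idx m) (Idx m) ℝ) (b : Idx m → ℝ) :
    arnoldiVec F A b 0 = flNormalize F b := by
  rw [arnoldiVec]

theorem arnoldiVec_succ (F : FloatArith u) (A : Matrix (Idx m) (Idx m) ℝ) (b : Idx m → ℝ)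
    (j : ℕ) : arnoldiVec F A b (j + 1) = flNormalize F (arnoldiNext F A b j) := by
  rw [arnoldiVec, ofFn_val_eq_map_range (arnoldiVec F A b)]
  rfl

theorem arnoldiSubdiag_eq (F : FloatArith u) (A : Matrix (Idx m) (Idx m) ℝ) (b : Idx m → ℝ)
    (j : ℕ) : arnoldiSubdiag F A b j = flNorm F (arnoldiNext F A b j) := by
  rw [arnoldiSubdiag, ofFn_val_eq_map_range (arnoldiVec F A b)]
  rfl

/-- Values and derivatives of a polynomial at the nodes. -/
noncomputable def hermiteVec (t : Fin m → ℝ) : ℝ[X] →ₗ[ℝ] (Idx m → ℝ) where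
  toFun p := Sum.elim (fun i => p.eval (t i)) (fun i => p.derivative.eval (t i))
  map_add' p q := by ext (i | i) <;> simp
  map_smul' c p := by ext (i | i) <;> simp

theorem hermiteVec_one (t : Fin m → ℝ) : hermiteVec t 1 = startVec m := by
  ext (i | i) <;> simp [hermiteVec, startVec]

/-- The product rule (Xp)' = p + Xp': the identity block supplies the term p. -/
theorem confluentOp_mulVec_hermiteVec (t : Fin m → ℝ) (p : ℝ[X]) :
    (confluentOp t).mulVec (hermiteVec t p) = hermiteVec t (X * p) := by
  ext (i | i) <;> simp [hermiteVec, confluentOp, Matrix.fromBlocks_mulVec, Matrix.mulVec_diagonal]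

/-- Otherwise every node is a root of multiplicity at least two, and distinct nodes give 2m roots,
more than the degree. -/
theorem hermiteVec_ne_zero {t : Fin m → ℝ} (ht : Function.Injective t) {p : ℝ[X]} {d : ℕ}
    (hp : p.degree = d) (hd : d < 2 * m) : hermiteVec t p ≠ 0 := by
  intro h0
  have hp0 : p ≠ 0 := by
    rintro rfl
    simp at hp
  have hroot : ∀ i, 1 < p.rootMultiplicity (t i) := fun i =>
    (one_lt_rootMultiplicity_iff_isRoot hp0).2
      ⟨congrFun h0 (Sum.inl i), congrFun h0 (Sum.inr i)⟩
  have hle : 2 • (Finset.univ.map ⟨t, ht⟩).val ≤ p.roots := by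
    rw [Multiset.le_iff_count]
    intro a
    rw [Multiset.count_nsmul, count_roots]
    by_cases ha : a ∈ Finset.univ.map ⟨t, ht⟩
    · obtain ⟨i, -, rfl⟩ := Finset.mem_map.1 ha
      rw [Multiset.count_eq_one_of_mem (Finset.nodup _) ha]
      exact hroot i
    · rw [Multiset.count_eq_zero_of_notMem ha]
      simp
  have h1 := Multiset.card_le_card hle
  have h2 := p.card_roots'
  rw [natDegree_eq_of_degree_eq_some hp] at h2
  simp at h1
  omega

theorem dotProduct_self_pos_of_ne_zero {x : Idx m → ℝ} (hx : x ≠ 0) : 0 < x ⬝ᵥ x :=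
  lt_of_le_of_ne (Finset.sum_nonneg fun _ _ => mul_self_nonneg _)
    (fun h => hx (dotProduct_self_eq_zero.1 h.symm))

/-- Only multiples of polynomials of smaller degree are subtracted, so the leading term survives;
orthogonality plays no role. -/
theorem exists_mgs_exact_eq_hermiteVec {t : Fin m → ℝ} {d : ℕ} {v : ℕ → Idx m → ℝ}
    {w : Idx m → ℝ} (hw : ∃ p : ℝ[X], p.degree = d ∧ w = hermiteVec t p) {n : ℕ}
    (hv : ∀ i < n, ∃ p : ℝ[X], p.degree < d ∧ v i = hermiteVec t p) :
    ∃ p : ℝ[X], p.degree = d ∧ mgs FloatArith.exact v n w = hermiteVec t p := by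
  induction n with
  | zero => simpa using hw
  | succ n ih =>
    obtain ⟨p, hp, hpw⟩ := ih fun i hi => hv i (by omega)
    obtain ⟨q, hq, hqv⟩ := hv n (by omega)
    refine ⟨p - (v n ⬝ᵥ mgs FloatArith.exact v n w) • q, ?_, ?_⟩
    · rw [degree_sub_eq_left_of_degree_lt, hp]
      rw [hp]
      exact (degree_smul_le _ _).trans_lt hq
    · rw [mgs_succ, mgsStep_exact, map_sub, map_smul, ← hpw, ← hqv]

theorem exists_normalize_exact_eq_hermiteVec {t : Fin m → ℝ} (ht : Function.Injective t) {d : ℕ}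
    (hd : d < 2 * m) {w : Idx m → ℝ} (hw : ∃ p : ℝ[X], p.degree = d ∧ w = hermiteVec t p) :
    ∃ p : ℝ[X], p.degree = d ∧ flNormalize FloatArith.exact w = hermiteVec t p := by
  obtain ⟨p, hp, rfl⟩ := hw
  refine ⟨(√(hermiteVec t p ⬝ᵥ hermiteVec t p))⁻¹ • p, ?_, ?_⟩
  · rw [degree_smul_of_smul_regular, hp]
    refine IsSMulRegular.of_ne_zero (inv_ne_zero (Real.sqrt_ne_zero'.2 ?_))
    have h := hermiteVec_ne_zero ht hp hd
    exact dotProduct_self_pos_of_ne_zero h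
  · rw [flNormalize_exact, map_smul]

theorem exists_arnoldiNext_exact_of_forall {t : Fin m → ℝ} {j : ℕ}
    (h : ∀ i ≤ j, ∃ p : ℝ[X], p.degree = i ∧
      arnoldiVec FloatArith.exact (confluentOp t) (startVec m) i = hermiteVec t p) :
    ∃ p : ℝ[X], p.degree = (j + 1 : ℕ) ∧
      arnoldiNext FloatArith.exact (confluentOp t) (startVec m) j = hermiteVec t p := by
  have hv : ∀ i < j + 1, ∃ p : ℝ[X], p.degree < (j + 1 : ℕ) ∧
      arnoldiVec FloatArith.exact (confluentOp t) (startVec m) i = hermiteVec t p := by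
    intro i hi
    obtain ⟨p, hp, hpv⟩ := h i (by omega)
    exact ⟨p, by rw [hp]; exact_mod_cast hi, hpv⟩
  refine exists_mgs_exact_eq_hermiteVec (exists_mgs_exact_eq_hermiteVec ?_ hv) hv
  obtain ⟨p, hp, hpv⟩ := h j le_rfl
  refine ⟨X * p, ?_, ?_⟩
  · rw [degree_mul, hp, degree_X, add_comm]
    rfl
  · rw [flMulVec_exact, hpv, confluentOp_mulVec_hermiteVec]

theorem exists_arnoldiVec_exact_eq_hermiteVec {t : Fin m → ℝ} (ht : Function.Injective t) {j : ℕ}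
    (hj : j < 2 * m) : ∃ p : ℝ[X], p.degree = j ∧
      arnoldiVec FloatArith.exact (confluentOp t) (startVec m) j = hermiteVec t p := by
  induction j using Nat.strong_induction_on with
  | _ j ih =>
    cases j with
    | zero =>
      rw [arnoldiVec_zero]
      exact exists_normalize_exact_eq_hermiteVec ht hj ⟨1, by simp, (hermiteVec_one t).symm⟩
    | succ j =>
      rw [arnoldiVec_succ]
      exact exists_normalize_exact_eq_hermiteVec ht hj
        (exists_arnoldiNext_exact_of_forall fun i hi => ih i (by omega) (by omega))

theorem arnoldiNext_exact_ne_zero {t : Fin m → ℝ} (ht : Function.Injective t) {j : ℕ}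
    (hj : j + 1 < 2 * m) :
    arnoldiNext FloatArith.exact (confluentOp t) (startVec m) j ≠ 0 := by
  obtain ⟨p, hp, h⟩ := exists_arnoldiNext_exact_of_forall (t := t) (j := j) fun _ _ =>
    exists_arnoldiVec_exact_eq_hermiteVec ht (by omega)
  rw [h]
  exact hermiteVec_ne_zero ht hp hj

theorem startVec_ne_zero (hm : 0 < m) : startVec m ≠ 0 := fun h => by
  simpa [startVec] using congrFun h (Sum.inl ⟨0, hm⟩)

theorem dotProduct_mgs_exact {v : ℕ → Idx m → ℝ} {n : ℕ}
    (hv : ∀ i < n, ∀ j < n, v i ⬝ᵥ v j = if i = j then 1 else 0) (w : Idx m → ℝ) :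
    ∀ i < n, v i ⬝ᵥ mgs FloatArith.exact v n w = 0 := by
  induction n with
  | zero => simp
  | succ n ih =>
    intro i hi
    rw [mgs_succ, mgsStep_exact, dotProduct_sub, dotProduct_smul, hv i hi n (by omega)]
    rcases (Nat.lt_succ_iff_lt_or_eq.1 hi) with h | rfl
    · rw [ih (fun i hi j hj => hv i (by omega) j (by omega)) i h]
      simp [h.ne]
    · simp

/-- With `dotProduct_mgs_exact`, this makes the second exact pass against an orthonormal family the
identity. -/
theorem mgs_exact_eq_self {v : ℕ → Idx m → ℝ} {n : ℕ} {w : Idx m → ℝ}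
    (h : ∀ i < n, v i ⬝ᵥ w = 0) : mgs FloatArith.exact v n w = w := by
  induction n with
  | zero => rfl
  | succ n ih =>
    rw [mgs_succ, ih fun i hi => h i (by omega), mgsStep_exact, h n (by omega)]
    simp

end Exact

/-! ### Convergence to exact arithmetic for fixed nodes. -/

section Limit

/-- A floating-point arithmetic together with its unit roundoff. -/
abbrev AnyArith : Type := Σ u : ℝ, FloatArith u

/-- The floating-point arithmetics as the unit roundoff, a non-negative number, tends to zero. -/
def smallRoundoff : Filter AnyArith := comap Sigma.fst (𝓝[≥] 0)

/-- Translates between the filter and the quantifiers on ε₀, ε and the arithmetic. The value ε = 0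
is included, so such statements also hold in exact arithmetic. -/
theorem eventually_smallRoundoff {P : AnyArith → Prop} :
    (∀ᶠ p in smallRoundoff, P p) ↔
      ∃ ε₀ : ℝ, 0 < ε₀ ∧ ∀ ε : ℝ, 0 ≤ ε → ε ≤ ε₀ → ∀ F : FloatArith ε, P ⟨ε, F⟩ := by
  rw [smallRoundoff, ((nhdsGE_basis_Icc (a := (0 : ℝ))).comap Sigma.fst).eventually_iff]
  constructor
  · rintro ⟨ε₀, h0, h⟩
    exact ⟨ε₀, h0, fun ε h1 h2 F => h ⟨h1, h2⟩⟩
  · rintro ⟨ε₀, h0, h⟩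
    exact ⟨ε₀, h0, fun p hp => h p.1 hp.1 hp.2 p.2⟩

theorem eventually_nonneg : ∀ᶠ p in smallRoundoff, 0 ≤ p.1 :=
  eventually_smallRoundoff.2 ⟨1, one_pos, fun _ h _ _ => h⟩

theorem eventually_le {c : ℝ} (hc : 0 < c) : ∀ᶠ p in smallRoundoff, p.1 ≤ c :=
  eventually_smallRoundoff.2 ⟨c, hc, fun _ _ h _ => h⟩

theorem eventually_mul_le (K : ℝ) {c : ℝ} (hc : 0 < c) :
    ∀ᶠ p in smallRoundoff, K * p.1 ≤ c := by
  filter_upwards [eventually_nonneg, eventually_le (div_pos hc (by positivity : 0 < |K| + 1))]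
    with p h0 h1
  rw [le_div_iff₀ (by positivity)] at h1
  nlinarith [le_abs_self K]

theorem tendsto_roundoff : Tendsto (fun p : AnyArith => p.1) smallRoundoff (𝓝 0) :=
  tendsto_comap.mono_right nhdsWithin_le_nhds

variable {m : ℕ}

theorem tendsto_of_abs_sub_le {f g : AnyArith → ℝ} {a : ℝ} (hg : Tendsto g smallRoundoff (𝓝 a))
    (h : ∀ᶠ p in smallRoundoff, |f p - g p| ≤ p.1 * |g p|) :
    Tendsto f smallRoundoff (𝓝 a) := by
  have h0 : Tendsto (fun p => f p - g p) smallRoundoff (𝓝 0) := by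
    refine squeeze_zero_norm' (a := fun p => p.1 * |g p|) h ?_
    simpa using tendsto_roundoff.mul hg.abs
  simpa using h0.add hg

section

variable {f g : AnyArith → ℝ} {a b : ℝ}

theorem tendsto_add (hf : Tendsto f smallRoundoff (𝓝 a)) (hg : Tendsto g smallRoundoff (𝓝 b)) :
    Tendsto (fun p => p.2.add (f p) (g p)) smallRoundoff (𝓝 (a + b)) :=
  tendsto_of_abs_sub_le (hf.add hg) (.of_forall fun p => p.2.add_err _ _)

theorem tendsto_sub (hf : Tendsto f smallRoundoff (𝓝 a)) (hg : Tendsto g smallRoundoff (𝓝 b)) :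
    Tendsto (fun p => p.2.sub (f p) (g p)) smallRoundoff (𝓝 (a - b)) :=
  tendsto_of_abs_sub_le (hf.sub hg) (.of_forall fun p => p.2.sub_err _ _)

theorem tendsto_mul (hf : Tendsto f smallRoundoff (𝓝 a)) (hg : Tendsto g smallRoundoff (𝓝 b)) :
    Tendsto (fun p => p.2.mul (f p) (g p)) smallRoundoff (𝓝 (a * b)) :=
  tendsto_of_abs_sub_le (hf.mul hg) (.of_forall fun p => p.2.mul_err _ _)

theorem tendsto_div (hf : Tendsto f smallRoundoff (𝓝 a)) (hg : Tendsto g smallRoundoff (𝓝 b))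
    (hb : b ≠ 0) : Tendsto (fun p => p.2.div (f p) (g p)) smallRoundoff (𝓝 (a / b)) :=
  tendsto_of_abs_sub_le (hf.div hg hb) ((hg.eventually_ne hb).mono fun p => p.2.div_err _ _)

theorem tendsto_sqrt (hf : Tendsto f smallRoundoff (𝓝 a)) (ha : 0 < a) :
    Tendsto (fun p => p.2.sqrt (f p)) smallRoundoff (𝓝 (√a)) :=
  tendsto_of_abs_sub_le hf.sqrt ((hf.eventually (lt_mem_nhds ha)).mono
    fun p hp => p.2.sqrt_err _ (le_of_lt hp))

end

section

variable {x y : AnyArith → Idx m → ℝ} {x₀ y₀ : Idx m → ℝ}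

theorem tendsto_flDot (hx : Tendsto x smallRoundoff (𝓝 x₀)) (hy : Tendsto y smallRoundoff (𝓝 y₀)) :
    Tendsto (fun p => flDot p.2 (x p) (y p)) smallRoundoff (𝓝 (flDot FloatArith.exact x₀ y₀)) := by
  have key : ∀ (l : List (Idx m)) (s : AnyArith → ℝ) (s₀ : ℝ), Tendsto s smallRoundoff (𝓝 s₀) →
      Tendsto (fun p => l.foldl (fun s i => p.2.add s (p.2.mul (x p i) (y p i))) (s p))
        smallRoundoff (𝓝 (l.foldl (fun s i =>
          FloatArith.exact.add s (FloatArith.exact.mul (x₀ i) (y₀ i))) s₀)) := by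
    intro l
    induction l with
    | nil => exact fun s s₀ h => h
    | cons i l ih =>
      intro s s₀ h
      exact ih _ _ (tendsto_add h
        (tendsto_mul (tendsto_pi_nhds.1 hx i) (tendsto_pi_nhds.1 hy i)))
  exact key _ _ _ tendsto_const_nhds

theorem tendsto_flMulVec (A : Matrix (Idx m) (Idx m) ℝ) (hx : Tendsto x smallRoundoff (𝓝 x₀)) :
    Tendsto (fun p => flMulVec p.2 A (x p)) smallRoundoff
      (𝓝 (flMulVec FloatArith.exact A x₀)) :=
  tendsto_pi_nhds.2 fun _ => tendsto_flDot tendsto_const_nhds hx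

theorem tendsto_flNorm (hx : Tendsto x smallRoundoff (𝓝 x₀)) (h0 : x₀ ≠ 0) :
    Tendsto (fun p => flNorm p.2 (x p)) smallRoundoff (𝓝 (flNorm FloatArith.exact x₀)) :=
  tendsto_sqrt (tendsto_flDot hx hx) (by
    rw [flDot_exact]
    exact dotProduct_self_pos_of_ne_zero h0)

theorem flNorm_exact_ne_zero (h0 : x₀ ≠ 0) : flNorm FloatArith.exact x₀ ≠ 0 := by
  rw [flNorm_exact]
  exact Real.sqrt_ne_zero'.2 (dotProduct_self_pos_of_ne_zero h0)

theorem tendsto_flNormalize (hx : Tendsto x smallRoundoff (𝓝 x₀)) (h0 : x₀ ≠ 0) :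
    Tendsto (fun p => flNormalize p.2 (x p)) smallRoundoff
      (𝓝 (flNormalize FloatArith.exact x₀)) :=
  tendsto_pi_nhds.2 fun i => tendsto_div (tendsto_pi_nhds.1 hx i) (tendsto_flNorm hx h0)
    (flNorm_exact_ne_zero h0)

theorem tendsto_mgs {v : AnyArith → ℕ → Idx m → ℝ} {v₀ : ℕ → Idx m → ℝ} {n : ℕ}
    (hv : ∀ i < n, Tendsto (fun p => v p i) smallRoundoff (𝓝 (v₀ i)))
    (hx : Tendsto x smallRoundoff (𝓝 x₀)) :
    Tendsto (fun p => mgs p.2 (v p) n (x p)) smallRoundoff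
      (𝓝 (mgs FloatArith.exact v₀ n x₀)) := by
  induction n with
  | zero => exact hx
  | succ n ih =>
    have h := ih fun i hi => hv i (by omega)
    have hn := hv n (by omega)
    simp only [mgs_succ]
    exact tendsto_pi_nhds.2 fun i => tendsto_sub (tendsto_pi_nhds.1 h i)
      (tendsto_mul (tendsto_flDot hn h) (tendsto_pi_nhds.1 hn i))

end

theorem tendsto_arnoldiNext_of_forall {A : Matrix (Idx m) (Idx m) ℝ} {b : Idx m → ℝ} {j : ℕ}
    (h : ∀ i ≤ j, Tendsto (fun p : AnyArith => arnoldiVec p.2 A b i) smallRoundoff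
      (𝓝 (arnoldiVec FloatArith.exact A b i))) :
    Tendsto (fun p : AnyArith => arnoldiNext p.2 A b j) smallRoundoff
      (𝓝 (arnoldiNext FloatArith.exact A b j)) :=
  tendsto_mgs (fun i hi => h i (by omega)) (tendsto_mgs (fun i hi => h i (by omega))
    (tendsto_flMulVec A (h j le_rfl)))

/-- Normalization is continuous away from zero, and the exact directions are nonzero. No rate is
claimed. -/
theorem tendsto_arnoldiVec {t : Fin m → ℝ} (ht : Function.Injective t) {j : ℕ} (hj : j < 2 * m) :
    Tendsto (fun p : AnyArith => arnoldiVec p.2 (confluentOp t) (startVec m) j) smallRoundoff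
      (𝓝 (arnoldiVec FloatArith.exact (confluentOp t) (startVec m) j)) := by
  induction j using Nat.strong_induction_on with
  | _ j ih =>
    cases j with
    | zero =>
      simp only [arnoldiVec_zero]
      exact tendsto_flNormalize tendsto_const_nhds (startVec_ne_zero (by omega))
    | succ j =>
      simp only [arnoldiVec_succ]
      exact tendsto_flNormalize
        (tendsto_arnoldiNext_of_forall fun i hi => ih i (by omega) (by omega))
        (arnoldiNext_exact_ne_zero ht hj)

theorem tendsto_arnoldiNext {t : Fin m → ℝ} (ht : Function.Injective t) {j : ℕ}
    (hj : j < 2 * m) :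
    Tendsto (fun p : AnyArith => arnoldiNext p.2 (confluentOp t) (startVec m) j) smallRoundoff
      (𝓝 (arnoldiNext FloatArith.exact (confluentOp t) (startVec m) j)) :=
  tendsto_arnoldiNext_of_forall fun _ hi => tendsto_arnoldiVec ht (by omega)

end Limit

/-! ### Rounding error bounds with constants independent of the nodes. -/

section Uniform

variable {m : ℕ}

/-- Here and below `‖·‖` is the sup norm of the function space, hence the factor 2m. -/
theorem abs_dotProduct_le (x y : Idx m → ℝ) : |x ⬝ᵥ y| ≤ 2 * m * (‖x‖ * ‖y‖) := by
  calc |x ⬝ᵥ y| ≤ ∑ i, |x i * y i| := Finset.abs_sum_le_sum_abs _ _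
    _ ≤ ∑ _i : Idx m, ‖x‖ * ‖y‖ := by
      refine Finset.sum_le_sum fun i _ => ?_
      rw [abs_mul]
      gcongr
      · exact norm_le_pi_norm x i
      · exact norm_le_pi_norm y i
    _ = _ := by
      rw [Finset.sum_const, Finset.card_univ, nsmul_eq_mul, Fintype.card_sum, Fintype.card_fin]
      push_cast
      ring

theorem abs_apply_le_sqrt (x : Idx m → ℝ) (i : Idx m) : |x i| ≤ √(x ⬝ᵥ x) := by
  apply Real.abs_le_sqrt
  rw [sq]
  exact Finset.single_le_sum (f := fun i => x i * x i) (fun i _ => mul_self_nonneg _)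
    (Finset.mem_univ i)

theorem norm_le_sqrt (x : Idx m → ℝ) : ‖x‖ ≤ √(x ⬝ᵥ x) :=
  (pi_norm_le_iff_of_nonneg (Real.sqrt_nonneg _)).2 (abs_apply_le_sqrt x)

theorem abs_flDot_sub_le {ε : ℝ} (h0 : 0 ≤ ε) (h1 : ε ≤ 1) (F : FloatArith ε)
    (x y : Idx m → ℝ) :
    |flDot F x y - x ⬝ᵥ y| ≤ 4 ^ (2 * m) * ε * ∑ i, |x i * y i| := by
  -- One summation step errs by at most 3ε(|s| + |x y|) and enlarges the accumulator at most
  -- fourfold; 4(4^l - 1) + 3 = 4^(l+1) - 1 closes the induction.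
  have key : ∀ (l : List (Idx m)) (s : ℝ),
      |l.foldl (fun s i => F.add s (F.mul (x i) (y i))) s - (s + (l.map fun i => x i * y i).sum)| ≤
        (4 ^ l.length - 1) * ε * (|s| + (l.map fun i => |x i * y i|).sum) := by
    intro l
    induction l with
    | nil => simp
    | cons a l ih =>
      intro s
      simp only [List.foldl_cons, List.map_cons, List.sum_cons, List.length_cons]
      set z := F.mul (x a) (y a)
      set s' := F.add s z
      set S := (l.map fun i => |x i * y i|).sum
      have hS : 0 ≤ S := List.sum_nonneg fun a ha => by
        obtain ⟨i, -, rfl⟩ := List.mem_map.1 ha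
        exact abs_nonneg _
      have hz := F.mul_err (x a) (y a)
      have hs := F.add_err s z
      have e1 : |s' - (s + x a * y a)| ≤ 3 * ε * (|s| + |x a * y a|) := by
        have hz' : |z| ≤ 2 * |x a * y a| := by
          have := abs_sub_abs_le_abs_sub z (x a * y a)
          nlinarith [abs_nonneg (x a * y a)]
        have h2 : |s' - (s + x a * y a)| ≤ |s' - (s + z)| + |z - x a * y a| := by
          refine (congrArg abs ?_).trans_le (abs_add_le (s' - (s + z)) (z - x a * y a))
          ring
        have h3 : ε * |s + z| ≤ ε * (|s| + 2 * |x a * y a|) := by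
          gcongr
          exact (abs_add_le _ _).trans (by linarith)
        have h4 : 0 ≤ ε * |s| := by positivity
        nlinarith
      have e2 : |s'| ≤ 4 * (|s| + |x a * y a|) := by
        have h2 := abs_sub_abs_le_abs_sub s' (s + x a * y a)
        have h3 := abs_add_le s (x a * y a)
        have h4 : ε * (|s| + |x a * y a|) ≤ 1 * (|s| + |x a * y a|) := by gcongr
        linarith
      have hc : (1 : ℝ) ≤ 4 ^ l.length := one_le_pow₀ (by norm_num)
      have h5 := abs_add_le
        (l.foldl (fun s i => F.add s (F.mul (x i) (y i))) s' -
          (s' + (l.map fun i => x i * y i).sum)) (s' - (s + x a * y a))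
      have h6 := ih s'
      have h7 : (4 ^ l.length - 1) * ε * (|s'| + S) ≤
          (4 ^ l.length - 1) * ε * (4 * (|s| + |x a * y a|) + S) := by
        have : 0 ≤ ((4 : ℝ) ^ l.length - 1) * ε := mul_nonneg (by linarith) h0
        gcongr
      have h8 : 0 ≤ (3 * (4 : ℝ) ^ l.length) * ε * S := by positivity
      calc _ = _ := by
            congr 1
            ring
        _ ≤ _ := h5
        _ ≤ (4 ^ l.length - 1) * ε * (4 * (|s| + |x a * y a|) + S) +
            3 * ε * (|s| + |x a * y a|) := add_le_add (h6.trans h7) e1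
        _ ≤ _ := by
          rw [pow_succ]
          linarith
  have h := key (rows m) 0
  rw [sum_map_rows, sum_map_rows, zero_add, abs_zero, zero_add] at h
  have hl : (rows m).length = 2 * m := by
    simp [rows]
    ring
  rw [hl] at h
  refine h.trans ?_
  gcongr
  linarith

theorem exists_norm_mgsStep_sub_le (m : ℕ) : ∃ C : ℝ, 0 ≤ C ∧ ∀ ε : ℝ, 0 ≤ ε → ε ≤ 1 →
    ∀ (F : FloatArith ε) (q w : Idx m → ℝ), ‖q‖ ≤ 2 →
      ‖mgsStep F q w - (w - (q ⬝ᵥ w) • q)‖ ≤ C * ε * ‖w‖ := by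
  set c : ℝ := 4 ^ (2 * m) with hc
  have hc0 : 0 ≤ c := by positivity
  set H : ℝ := (c + 1) * (4 * m) with hH
  have hH0 : 0 ≤ H := by positivity
  -- Contributions of the subtraction (1 + 4H), of the product (2H) and of the inner product; H‖w‖
  -- bounds the computed coefficient.
  refine ⟨1 + 4 * H + 2 * H + 2 * (c * (4 * m)), by positivity, fun ε h0 h1 F q w hq => ?_⟩
  rw [pi_norm_le_iff_of_nonneg (by positivity)]
  intro i
  have hqi : |q i| ≤ 2 := (norm_le_pi_norm q i).trans hq
  have hwi : |w i| ≤ ‖w‖ := norm_le_pi_norm w i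
  have hsum : ∑ i, |q i * w i| ≤ 4 * m * ‖w‖ := by
    calc ∑ i, |q i * w i| ≤ ∑ _i : Idx m, 2 * ‖w‖ := by
          refine Finset.sum_le_sum fun i _ => ?_
          rw [abs_mul]
          gcongr
          · exact (norm_le_pi_norm q i).trans hq
          · exact norm_le_pi_norm w i
      _ = _ := by
        rw [Finset.sum_const, Finset.card_univ, nsmul_eq_mul, Fintype.card_sum, Fintype.card_fin]
        push_cast
        ring
  have hdot : |q ⬝ᵥ w| ≤ 4 * m * ‖w‖ := (Finset.abs_sum_le_sum_abs _ _).trans hsum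
  set h := flDot F q w
  have e1 : |h - q ⬝ᵥ w| ≤ c * (4 * m) * ε * ‖w‖ := by
    refine (abs_flDot_sub_le h0 h1 F q w).trans ?_
    calc _ ≤ c * ε * (4 * m * ‖w‖) := by gcongr
      _ = _ := by ring
  have hh : |h| ≤ H * ‖w‖ := by
    have h2 := abs_sub_abs_le_abs_sub h (q ⬝ᵥ w)
    have h3 : c * (4 * m) * ε * ‖w‖ ≤ c * (4 * m) * 1 * ‖w‖ := by gcongr
    rw [hH]
    linarith
  have hhq : |h * q i| ≤ 2 * (H * ‖w‖) := by
    rw [abs_mul, mul_comm]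
    gcongr
  set g := F.mul h (q i)
  have e2 : |g - h * q i| ≤ ε * (2 * (H * ‖w‖)) :=
    (F.mul_err h (q i)).trans (by gcongr)
  have hg : |g| ≤ 4 * (H * ‖w‖) := by
    have h2 := abs_sub_abs_le_abs_sub g (h * q i)
    have h3 : ε * (2 * (H * ‖w‖)) ≤ 1 * (2 * (H * ‖w‖)) := by gcongr
    linarith
  have e3 : |F.sub (w i) g - (w i - g)| ≤ ε * (‖w‖ + 4 * (H * ‖w‖)) := by
    refine (F.sub_err _ _).trans ?_
    gcongr
    exact (abs_sub _ _).trans (add_le_add hwi hg)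
  have e4 : |(h - q ⬝ᵥ w) * q i| ≤ (c * (4 * m) * ε * ‖w‖) * 2 := by
    rw [abs_mul]
    gcongr
  have hsplit : (mgsStep F q w - (w - (q ⬝ᵥ w) • q)) i =
      (F.sub (w i) g - (w i - g)) - (g - h * q i) - (h - q ⬝ᵥ w) * q i := by
    simp only [mgsStep, Pi.sub_apply, Pi.smul_apply, smul_eq_mul]
    ring
  rw [Real.norm_eq_abs, hsplit]
  refine (abs_sub _ _).trans ((add_le_add (abs_sub _ _) le_rfl).trans ?_)
  linarith

/-- The first `n` vectors of a sequence are orthonormal up to an error `δ` in the Gram matrix. -/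
def NearOrthonormal (δ : ℝ) (v : ℕ → Idx m → ℝ) (n : ℕ) : Prop :=
  ∀ i < n, ∀ j < n, |v i ⬝ᵥ v j - if i = j then 1 else 0| ≤ δ

theorem NearOrthonormal.mono {δ : ℝ} {v : ℕ → Idx m → ℝ} {n n' : ℕ} (h : NearOrthonormal δ v n)
    (hn : n' ≤ n) : NearOrthonormal δ v n' :=
  fun i hi j hj => h i (by omega) j (by omega)

theorem NearOrthonormal.norm_le_two {δ : ℝ} {v : ℕ → Idx m → ℝ} {n : ℕ}
    (h : NearOrthonormal δ v n) (hδ : δ ≤ 1) {i : ℕ} (hi : i < n) : ‖v i‖ ≤ 2 := by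
  refine (norm_le_sqrt _).trans (Real.sqrt_le_iff.2 ⟨by norm_num, ?_⟩)
  have := (abs_le.1 (h i hi i hi)).2
  rw [if_pos rfl] at this
  linarith

/-- Removing the component along q leaves only (q·x)(1 - q·q) and a rounding error. It disturbs an
earlier component by (q·x)(vᵢ·q), again O(ε), plus rounding. -/
theorem exists_abs_dotProduct_mgs_le (m : ℕ) (K : ℝ) (hK : 0 ≤ K) (n : ℕ) :
    ∃ C : ℝ, 0 ≤ C ∧ ∀ ε : ℝ, 0 ≤ ε → ε ≤ 1 → K * ε ≤ 1 →
      ∀ (F : FloatArith ε) (v : ℕ → Idx m → ℝ) (w : Idx m → ℝ), NearOrthonormal (K * ε) v n →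
        ‖mgs F v n w‖ ≤ C * ‖w‖ ∧ ∀ i < n, |v i ⬝ᵥ mgs F v n w| ≤ C * ε * ‖w‖ := by
  obtain ⟨C₁, hC₁, hstep⟩ := exists_norm_mgsStep_sub_le m
  induction n with
  | zero => exact ⟨1, zero_le_one, fun ε _ _ _ F v w _ => by simp⟩
  | succ n ih =>
    obtain ⟨C, hC, hmgs⟩ := ih
    refine ⟨C * (1 + 8 * m + C₁ + 4 * m * K + 4 * m * C₁), by positivity,
      fun ε h0 h1 hKε F v w hv => ?_⟩
    obtain ⟨hn, hdot⟩ := hmgs ε h0 h1 hKε F v w (hv.mono (by omega))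
    rw [mgs_succ]
    set x := mgs F v n w
    set q := v n with hqv
    have hq : ‖q‖ ≤ 2 := hv.norm_le_two hKε (by omega)
    obtain ⟨e, he⟩ : ∃ e, mgsStep F q x = x - (q ⬝ᵥ x) • q + e :=
      ⟨_, (add_sub_cancel _ _).symm⟩
    have hqx : |q ⬝ᵥ x| ≤ 4 * m * (C * ‖w‖) := by
      refine (abs_dotProduct_le q x).trans ?_
      calc 2 * m * (‖q‖ * ‖x‖) ≤ 2 * m * (2 * (C * ‖w‖)) := by gcongr
        _ = _ := by ring
    have he' : ‖e‖ ≤ C₁ * ε * (C * ‖w‖) := by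
      have h := hstep ε h0 h1 F q x hq
      rw [he, add_sub_cancel_left] at h
      exact h.trans (by gcongr)
    have hve : ∀ i < n + 1, |v i ⬝ᵥ e| ≤ 4 * m * (C₁ * ε * (C * ‖w‖)) := by
      intro i hi
      refine (abs_dotProduct_le _ e).trans ?_
      calc 2 * m * (‖v i‖ * ‖e‖) ≤ 2 * m * (2 * (C₁ * ε * (C * ‖w‖))) := by
            gcongr
            exact hv.norm_le_two hKε hi
        _ = _ := by ring
    have p1 : 0 ≤ C * (4 * m * K) * ‖w‖ := by positivity
    have p2 : 0 ≤ C * (4 * m * C₁) * ‖w‖ := by positivity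
    have p3 : 0 ≤ C * ε * ‖w‖ := by positivity
    have p4 : 0 ≤ C * (8 * m + C₁) * ε * ‖w‖ := by positivity
    rw [he]
    constructor
    · have h2 : ‖(q ⬝ᵥ x) • q‖ ≤ 4 * m * (C * ‖w‖) * 2 := by
        rw [norm_smul]
        gcongr
        exact hqx
      have h3 : C₁ * ε * (C * ‖w‖) ≤ C₁ * 1 * (C * ‖w‖) := by gcongr
      refine (norm_add_le _ _).trans ((add_le_add (norm_sub_le _ _) le_rfl).trans ?_)
      linarith
    · intro i hi
      have h2 := hve i hi
      have hvq := hv i hi n (by omega)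
      rw [← hqv] at hvq
      have hprod : ∀ z : ℝ, |z| ≤ K * ε → |q ⬝ᵥ x * z| ≤ 4 * m * (C * ‖w‖) * (K * ε) := by
        intro z hz
        rw [abs_mul]
        gcongr
      rcases Nat.lt_succ_iff_lt_or_eq.1 hi with hlt | rfl
      · have hsplit : v i ⬝ᵥ (x - (q ⬝ᵥ x) • q + e) =
            v i ⬝ᵥ x - q ⬝ᵥ x * (v i ⬝ᵥ q) + v i ⬝ᵥ e := by
          rw [dotProduct_add, dotProduct_sub, dotProduct_smul, smul_eq_mul]
        rw [if_neg hlt.ne, sub_zero] at hvq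
        have h3 := hprod _ hvq
        have h4 := hdot i hlt
        rw [hsplit]
        refine (abs_add_le _ _).trans ((add_le_add (abs_sub _ _) le_rfl).trans ?_)
        linarith
      · have hsplit : v i ⬝ᵥ (x - (q ⬝ᵥ x) • q + e) =
            v i ⬝ᵥ e - q ⬝ᵥ x * (v i ⬝ᵥ q - 1) := by
          rw [dotProduct_add, dotProduct_sub, dotProduct_smul, smul_eq_mul, ← hqv]
          ring
        rw [if_pos rfl] at hvq
        have h3 := hprod _ hvq
        rw [hsplit]
        refine (abs_sub _ _).trans ?_
        linarith

theorem exists_abs_flNormalize_sub_le (m : ℕ) : ∃ C : ℝ, 1 ≤ C ∧ ∀ ε : ℝ, 0 ≤ ε → C * ε ≤ 1 →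
    ∀ (F : FloatArith ε) (w : Idx m → ℝ), w ≠ 0 →
      ∀ i, |flNormalize F w i - w i / √(w ⬝ᵥ w)| ≤ C * ε := by
  set c : ℝ := 4 ^ (2 * m) with hc
  have hc0 : 0 ≤ c := by positivity
  -- 2(c + 2) from the relative error of the computed norm, 2 from the division.
  refine ⟨2 * c + 6, by linarith, fun ε h0 hCε F w hw i => ?_⟩
  have hcε : 0 ≤ c * ε := by positivity
  have h1 : ε ≤ 1 := by linarith
  have hs := dotProduct_self_pos_of_ne_zero hw
  have hwi := abs_apply_le_sqrt w i
  have hd : |flDot F w w - w ⬝ᵥ w| ≤ c * ε * (w ⬝ᵥ w) := by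
    refine (abs_flDot_sub_le h0 h1 F w w).trans_eq ?_
    simp only [abs_mul_self]
    rfl
  have hN : 0 < √(w ⬝ᵥ w) := Real.sqrt_pos.2 hs
  have hNN : √(w ⬝ᵥ w) * √(w ⬝ᵥ w) = w ⬝ᵥ w := Real.mul_self_sqrt hs.le
  set N := √(w ⬝ᵥ w)
  set s := w ⬝ᵥ w
  set d := flDot F w w with hdd
  have hd2 := abs_le.1 hd
  -- Keeps the computed sum of squares nonnegative, as the square root error bound requires.
  have hcs : c * ε * s ≤ 1 / 2 * s := by
    gcongr
    linarith
  have hd0 : 0 ≤ d := by linarith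
  have hrr : √d * √d = d := Real.mul_self_sqrt hd0
  have hr0 := Real.sqrt_nonneg d
  have hr2 : √d ≤ 2 * N := by nlinarith
  have e1 : |√d - N| ≤ c * ε * N := by
    have h2 : |√d - N| * (√d + N) = |d - s| := by
      have h3 : d - s = (√d - N) * (√d + N) := by linear_combination hNN - hrr
      rw [h3, abs_mul, abs_of_nonneg (by positivity : 0 ≤ √d + N)]
    have h3 : |√d - N| * N ≤ c * ε * N * N := by
      nlinarith [mul_nonneg (abs_nonneg (√d - N)) hr0]
    exact le_of_mul_le_mul_right h3 hN
  have e2 := F.sqrt_err d hd0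
  rw [abs_of_nonneg hr0] at e2
  have hn : flNorm F w = F.sqrt d := rfl
  set n := flNorm F w
  have e3 : |n - N| ≤ (c + 2) * ε * N := by
    have h2 := abs_add_le (F.sqrt d - √d) (√d - N)
    rw [sub_add_sub_cancel, ← hn] at h2
    rw [← hn] at e2
    have h3 : ε * √d ≤ ε * (2 * N) := by gcongr
    linarith
  have hnN : N / 2 ≤ n := by
    have h2 := (abs_le.1 e3).1
    have h3 : (c + 2) * ε * N ≤ 1 / 2 * N := by
      gcongr
      linarith
    linarith
  have hn0 : 0 < n := by linarith
  have e4 := F.div_err (w i) n hn0.ne'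
  have hwn : |w i / n| ≤ 2 := by
    rw [abs_div, abs_of_pos hn0, div_le_iff₀ hn0]
    linarith
  have e5 : |w i / n - w i / N| ≤ 2 * ((c + 2) * ε) := by
    have h2 : w i / n - w i / N = (w i / n) * (-(n - N) / N) := by
      field_simp
      ring
    rw [h2, abs_mul, abs_div (-(n - N)), abs_neg, abs_of_pos hN]
    gcongr
    rwa [div_le_iff₀ hN]
  have h6 := abs_add_le (F.div (w i) n - w i / n) (w i / n - w i / N)
  rw [sub_add_sub_cancel] at h6
  have h7 : ε * |w i / n| ≤ ε * 2 := by gcongr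
  change |F.div (w i) n - w i / N| ≤ _
  linarith

theorem exists_dotProduct_flNormalize_le (m : ℕ) : ∃ C : ℝ, 0 ≤ C ∧ ∀ ε : ℝ, 0 ≤ ε → C * ε ≤ 1 →
    ∀ (F : FloatArith ε) (w : Idx m → ℝ), w ≠ 0 →
      |flNormalize F w ⬝ᵥ flNormalize F w - 1| ≤ C * ε ∧
      ∀ v : Idx m → ℝ, ‖v‖ ≤ 2 → ∀ B : ℝ, |v ⬝ᵥ w| ≤ B * √(w ⬝ᵥ w) →
        |v ⬝ᵥ flNormalize F w| ≤ B + C * ε := by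
  obtain ⟨C, hC, h⟩ := exists_abs_flNormalize_sub_le m
  refine ⟨C + 6 * m * C, by positivity, fun ε h0 hCε F w hw => ?_⟩
  have hmC : 0 ≤ m * C * ε := by positivity
  have hCε0 : 0 ≤ C * ε := by positivity
  have hi := h ε h0 (by linarith) F w hw
  set N := √(w ⬝ᵥ w) with hNdef
  have hs := dotProduct_self_pos_of_ne_zero hw
  have hN : 0 < N := Real.sqrt_pos.2 hs
  have hNN : N * N = w ⬝ᵥ w := Real.mul_self_sqrt hs.le
  set q := flNormalize F w
  obtain ⟨e, he⟩ : ∃ e, q = N⁻¹ • w + e := ⟨_, (add_sub_cancel _ _).symm⟩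
  have hen : ‖e‖ ≤ C * ε := by
    rw [pi_norm_le_iff_of_nonneg hCε0]
    intro i
    have h2 := hi i
    have h3 : q i - w i / N = e i := by
      rw [he, Pi.add_apply, Pi.smul_apply, smul_eq_mul]
      field_simp
      ring
    rwa [h3] at h2
  have hx : ‖N⁻¹ • w‖ ≤ 1 := by
    rw [norm_smul, norm_inv, Real.norm_of_nonneg hN.le, inv_mul_le_iff₀ hN, mul_one]
    exact norm_le_sqrt w
  constructor
  · have hsplit : q ⬝ᵥ q - 1 = 2 * ((N⁻¹ • w) ⬝ᵥ e) + e ⬝ᵥ e := by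
      have h4 : (N⁻¹ • w) ⬝ᵥ (N⁻¹ • w) = 1 := by
        rw [smul_dotProduct, dotProduct_smul, ← hNN, smul_eq_mul, smul_eq_mul]
        field_simp
      rw [he, dotProduct_add, add_dotProduct, add_dotProduct, h4, dotProduct_comm e]
      ring
    have h5 : |2 * ((N⁻¹ • w) ⬝ᵥ e)| ≤ 4 * (m * C * ε) := by
      rw [abs_mul, abs_two]
      calc 2 * |(N⁻¹ • w) ⬝ᵥ e| ≤ 2 * (2 * m * (1 * (C * ε))) := by
            gcongr
            exact (abs_dotProduct_le _ _).trans (by gcongr)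
        _ = _ := by ring
    have h6 : |e ⬝ᵥ e| ≤ 2 * (m * C * ε) := by
      refine (abs_dotProduct_le _ _).trans ?_
      calc 2 * m * (‖e‖ * ‖e‖) ≤ 2 * m * (1 * (C * ε)) := by
            gcongr
            linarith
        _ = _ := by ring
    rw [hsplit]
    refine (abs_add_le _ _).trans ?_
    linarith
  · intro v hv B hB
    have h5 : |v ⬝ᵥ (N⁻¹ • w)| ≤ B := by
      rwa [dotProduct_smul, smul_eq_mul, abs_mul, abs_inv, abs_of_pos hN, inv_mul_le_iff₀ hN,
        mul_comm]
    have h6 : |v ⬝ᵥ e| ≤ 4 * (m * C * ε) := by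
      refine (abs_dotProduct_le _ _).trans ?_
      calc 2 * m * (‖v‖ * ‖e‖) ≤ 2 * m * (2 * (C * ε)) := by gcongr
        _ = _ := by ring
    rw [he, dotProduct_add]
    refine (abs_add_le _ _).trans ?_
    linarith

/-- Exact arithmetic is the case ε = 0, where the error bound Kε vanishes. -/
theorem nearOrthonormal_exact {t : Fin m → ℝ} {K : ℝ} {n : ℕ}
    (h : ∀ᶠ p in smallRoundoff,
      NearOrthonormal (K * p.1) (arnoldiVec p.2 (confluentOp t) (startVec m)) n) :
    ∀ i < n, ∀ j < n,
      arnoldiVec FloatArith.exact (confluentOp t) (startVec m) i ⬝ᵥ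
        arnoldiVec FloatArith.exact (confluentOp t) (startVec m) j = if i = j then 1 else 0 := by
  obtain ⟨ε₀, h0, h⟩ := eventually_smallRoundoff.1 h
  intro i hi j hj
  have h2 := h 0 le_rfl h0.le FloatArith.exact i hi j hj
  rw [mul_zero] at h2
  exact sub_eq_zero.1 (abs_nonpos_iff.1 h2)

/-- The second Gram-Schmidt pass does not shorten its input by more than a factor of two. -/
theorem eventually_norm_mgs_le {t : Fin m → ℝ} (ht : Function.Injective t) {j : ℕ}
    (hj : j + 1 < 2 * m) (h : ∀ i < j + 1, ∀ l < j + 1,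
      arnoldiVec FloatArith.exact (confluentOp t) (startVec m) i ⬝ᵥ
        arnoldiVec FloatArith.exact (confluentOp t) (startVec m) l = if i = l then 1 else 0) :
    ∀ᶠ p in smallRoundoff,
      ‖mgs p.2 (arnoldiVec p.2 (confluentOp t) (startVec m)) (j + 1)
          (flMulVec p.2 (confluentOp t) (arnoldiVec p.2 (confluentOp t) (startVec m) j))‖ <
        2 * ‖arnoldiNext p.2 (confluentOp t) (startVec m) j‖ := by
  have hv : ∀ i < j + 1, Tendsto (fun p : AnyArith =>
      arnoldiVec p.2 (confluentOp t) (startVec m) i) smallRoundoff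
      (𝓝 (arnoldiVec FloatArith.exact (confluentOp t) (startVec m) i)) :=
    fun _ _ => tendsto_arnoldiVec ht (by omega)
  have h1 := (tendsto_mgs hv (tendsto_flMulVec (confluentOp t) (hv j (by omega)))).norm
  have h2 := (tendsto_arnoldiNext ht (by omega : j < 2 * m)).norm.const_mul 2
  refine h1.eventually_lt h2 ?_
  have h3 := norm_pos_iff.2 (arnoldiNext_exact_ne_zero ht hj)
  -- The exact second pass is the identity, so the two limits are a and 2a with a > 0.
  rw [arnoldiNext, mgs_exact_eq_self (dotProduct_mgs_exact h _)] at h3 ⊢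
  linarith

theorem exists_eventually_nearOrthonormal (m n : ℕ) (hn : n + 1 ≤ 2 * m) :
    ∃ K : ℝ, 0 ≤ K ∧ ∀ t : Fin m → ℝ, Function.Injective t → ∀ᶠ p in smallRoundoff,
      NearOrthonormal (K * p.1) (arnoldiVec p.2 (confluentOp t) (startVec m)) (n + 1) := by
  obtain ⟨C, hC, hnorm⟩ := exists_dotProduct_flNormalize_le m
  induction n with
  | zero =>
    refine ⟨C, hC, fun t ht => ?_⟩
    filter_upwards [eventually_nonneg, eventually_mul_le C one_pos] with p h0 h1
    intro i hi j hj
    obtain rfl : i = 0 := by omega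
    obtain rfl : j = 0 := by omega
    rw [if_pos rfl, arnoldiVec_zero]
    exact (hnorm p.1 h0 h1 p.2 _ (startVec_ne_zero (by omega))).1
  | succ n ih =>
    obtain ⟨K, hK, horth⟩ := ih (by omega)
    obtain ⟨C', hC', hmgs⟩ := exists_abs_dotProduct_mgs_le m K hK (n + 1)
    -- K covers the old Gram entries, C the normalization, and 2C' the second pass, whose input is
    -- less than twice its output. The constant is chosen before the nodes.
    refine ⟨K + C + 2 * C', by positivity, fun t ht => ?_⟩
    filter_upwards [eventually_nonneg, eventually_mul_le C one_pos, eventually_mul_le K one_pos,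
      eventually_le one_pos, horth t ht,
      eventually_norm_mgs_le ht (by omega) (nearOrthonormal_exact (horth t ht)),
      (tendsto_arnoldiNext ht (by omega : n < 2 * m)).eventually_ne
        (arnoldiNext_exact_ne_zero ht (by omega))] with p h0 hCp hKp h1 hv hw hne
    set v := arnoldiVec p.2 (confluentOp t) (startVec m) with hvdef
    set w := arnoldiNext p.2 (confluentOp t) (startVec m) n with hwdef
    have hlast : v (n + 1) = flNormalize p.2 w := arnoldiVec_succ _ _ _ _
    obtain ⟨hself, hcross⟩ := hnorm p.1 h0 hCp p.2 w hne
    have hKp0 : 0 ≤ K * p.1 := by positivity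
    have hCp0 : 0 ≤ C * p.1 := by positivity
    have hCp0' : 0 ≤ C' * p.1 := by positivity
    have hnew : ∀ i < n + 1, |v i ⬝ᵥ v (n + 1)| ≤ (K + C + 2 * C') * p.1 := by
      intro i hi
      rw [hlast]
      refine (hcross (v i) (hv.norm_le_two hKp hi) (2 * C' * p.1) ?_).trans (by linarith)
      refine ((hmgs p.1 h0 h1 hKp p.2 v _ hv).2 i hi).trans ?_
      calc _ ≤ C' * p.1 * (2 * ‖w‖) := by gcongr
        _ ≤ C' * p.1 * (2 * √(w ⬝ᵥ w)) := by
          gcongr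
          exact norm_le_sqrt w
        _ = _ := by ring
    intro i hi j hj
    rcases Nat.lt_succ_iff_lt_or_eq.1 hi with hi' | rfl
    · rcases Nat.lt_succ_iff_lt_or_eq.1 hj with hj' | rfl
      · exact (hv i hi' j hj').trans (by linarith)
      · rw [if_neg hi'.ne, sub_zero]
        exact hnew i hi'
    · rcases Nat.lt_succ_iff_lt_or_eq.1 hj with hj' | rfl
      · rw [if_neg hj'.ne', sub_zero, dotProduct_comm]
        exact hnew j hj'
      · rw [if_pos rfl, hlast]
        exact hself.trans (by linarith)

end Uniform

/-! ### From a Gram matrix near the identity to the condition number. -/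

section Condition

variable {ι κ : Type*} [Fintype ι] [Fintype κ] [DecidableEq κ]

/-- The difference is xᵀ(AᵀA - I)x, at most δ(∑|xᵢ|)² in absolute value; Cauchy-Schwarz then gives
the factor `card κ`. -/
theorem abs_norm_mulVec_sq_sub_le {A : Matrix ι κ ℝ} {δ : ℝ}
    (h : ∀ i j, |(A.transpose * A) i j - (1 : Matrix κ κ ℝ) i j| ≤ δ) (x : EuclideanSpace ℝ κ) :
    |‖WithLp.toLp 2 (A.mulVec x.ofLp)‖ ^ 2 - ‖x‖ ^ 2| ≤ Fintype.card κ * δ * ‖x‖ ^ 2 := by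
  have h1 : ‖WithLp.toLp 2 (A.mulVec x.ofLp)‖ ^ 2 - ‖x‖ ^ 2 =
      ∑ i, ∑ j, x i * x j * ((A.transpose * A) i j - (1 : Matrix κ κ ℝ) i j) := by
    have h2 : ‖WithLp.toLp 2 (A.mulVec x.ofLp)‖ ^ 2 =
        x.ofLp ⬝ᵥ (A.transpose * A).mulVec x.ofLp := by
      rw [← Matrix.mulVec_mulVec, Matrix.dotProduct_mulVec, Matrix.vecMul_transpose,
        EuclideanSpace.real_norm_sq_eq]
      simp only [dotProduct, sq]
    have h3 : ‖x‖ ^ 2 = x.ofLp ⬝ᵥ (1 : Matrix κ κ ℝ).mulVec x.ofLp := by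
      rw [Matrix.one_mulVec, EuclideanSpace.real_norm_sq_eq]
      simp only [dotProduct, sq]
    rw [h2, h3, ← dotProduct_sub, ← Matrix.sub_mulVec]
    simp only [dotProduct, Matrix.mulVec, Finset.mul_sum, Matrix.sub_apply]
    exact Finset.sum_congr rfl fun i _ => Finset.sum_congr rfl fun j _ => by ring
  have h4 : (∑ i, |x i|) ^ 2 ≤ Fintype.card κ * ‖x‖ ^ 2 := by
    rw [EuclideanSpace.norm_sq_eq]
    exact sq_sum_le_card_mul_sum_sq
  rcases isEmpty_or_nonempty κ with hκ | ⟨⟨k⟩⟩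
  · rw [h1]
    simp
  have hδ : 0 ≤ δ := (abs_nonneg _).trans (h k k)
  rw [h1]
  calc _ ≤ ∑ i, ∑ j, |x i| * |x j| * δ := by
        refine (Finset.abs_sum_le_sum_abs _ _).trans (Finset.sum_le_sum fun i _ => ?_)
        refine (Finset.abs_sum_le_sum_abs _ _).trans (Finset.sum_le_sum fun j _ => ?_)
        rw [abs_mul, abs_mul]
        gcongr
        exact h i j
    _ = (∑ i, |x i|) ^ 2 * δ := by
      rw [sq, Finset.sum_mul_sum, Finset.sum_mul]
      exact Finset.sum_congr rfl fun i _ => (Finset.sum_mul _ _ _).symm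
    _ ≤ Fintype.card κ * ‖x‖ ^ 2 * δ := by gcongr
    _ = _ := by ring

theorem linearIndependent_col_of_nearOrthonormal {A : Matrix ι κ ℝ} {δ : ℝ}
    (h : ∀ i j, |(A.transpose * A) i j - (1 : Matrix κ κ ℝ) i j| ≤ δ)
    (hδ : Fintype.card κ * δ < 1) : LinearIndependent ℝ A.col := by
  rw [← Matrix.mulVec_injective_iff]
  refine (injective_iff_map_eq_zero A.mulVecLin).2 fun x hx => ?_
  have h1 := abs_norm_mulVec_sq_sub_le h (WithLp.toLp 2 x)
  rw [Matrix.mulVecLin_apply] at hx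
  simp only [hx, WithLp.toLp_zero, norm_zero] at h1
  have h2 : ‖WithLp.toLp 2 x‖ ^ 2 = 0 := by
    rw [zero_pow two_ne_zero, zero_sub, abs_neg, abs_of_nonneg (by positivity)] at h1
    nlinarith [sq_nonneg ‖WithLp.toLp 2 x‖]
  simpa using h2

theorem abs_cond₂_sub_one_le [Nonempty κ] {A : Matrix ι κ ℝ} {δ : ℝ}
    (h : ∀ i j, |(A.transpose * A) i j - (1 : Matrix κ κ ℝ) i j| ≤ δ)
    (hδ : Fintype.card κ * δ ≤ 1 / 2) : |cond₂ A - 1| ≤ 4 * (Fintype.card κ * δ) := by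
  set η := Fintype.card κ * δ with hη
  set f : Metric.sphere (0 : EuclideanSpace ℝ κ) 1 → ℝ :=
    fun x => ‖WithLp.toLp 2 (A.mulVec (WithLp.ofLp x.1))‖ with hf
  have hne : Nonempty (Metric.sphere (0 : EuclideanSpace ℝ κ) 1) :=
    (NormedSpace.sphere_nonempty.2 zero_le_one).to_subtype
  have hfx : ∀ x, |f x - 1| ≤ η := by
    intro x
    have h1 := abs_norm_mulVec_sq_sub_le h x.1
    rw [mem_sphere_zero_iff_norm.1 x.2, one_pow, mul_one] at h1
    change |f x ^ 2 - 1| ≤ η at h1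
    have h2 : 0 ≤ f x := norm_nonneg _
    have h3 : |f x ^ 2 - 1| = |f x - 1| * (f x + 1) := by
      have h4 : f x ^ 2 - 1 = (f x - 1) * (f x + 1) := by ring
      rw [h4, abs_mul, abs_of_nonneg (by positivity : 0 ≤ f x + 1)]
    nlinarith [abs_nonneg (f x - 1)]
  have hub : ∀ x, f x ≤ 1 + η := fun x => by linarith [(abs_le.1 (hfx x)).2]
  have hlb : ∀ x, 1 - η ≤ f x := fun x => by linarith [(abs_le.1 (hfx x)).1]
  have hsup : ⨆ x, f x ≤ 1 + η := ciSup_le hub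
  have hinf : 1 - η ≤ ⨅ x, f x := le_ciInf hlb
  have hle : ⨅ x, f x ≤ ⨆ x, f x := by
    obtain ⟨x⟩ := hne
    exact (ciInf_le ⟨1 - η, Set.forall_mem_range.2 hlb⟩ x).trans
      (le_ciSup (f := f) ⟨1 + η, Set.forall_mem_range.2 hub⟩ x)
  have hpos : 0 < ⨅ x, f x := by linarith
  change |(⨆ x, f x) / (⨅ x, f x) - 1| ≤ 4 * η
  -- (sup - inf)/inf ≤ 2η/(1 - η) ≤ 4η, since η ≤ 1/2.
  rw [div_sub_one hpos.ne', abs_of_nonneg (div_nonneg (by linarith) hpos.le), div_le_iff₀ hpos]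
  have hη0 : 0 ≤ η := by linarith
  nlinarith

end Condition

end CVA

theorem theorem2 (m k : ℕ) (hk : k + 1 ≤ 2 * m) :
    ∃ K : ℝ, 0 < K ∧ ∀ t : Fin m → ℝ, Function.Injective t →
      ∃ ε₀ : ℝ, 0 < ε₀ ∧ ∀ ε : ℝ, 0 ≤ ε → ε ≤ ε₀ → ∀ F : CVA.FloatArith ε,
        CVA.flNorm F (CVA.startVec m) ≠ 0 ∧
        (∀ j < k, CVA.arnoldiSubdiag F (CVA.confluentOp t) (CVA.startVec m) j ≠ 0) ∧
        LinearIndependent ℝ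
          (CVA.arnoldiBasis F (CVA.confluentOp t) (CVA.startVec m) k).col ∧
        |CVA.cond₂ (CVA.arnoldiBasis F (CVA.confluentOp t) (CVA.startVec m) k) - 1| ≤ K * ε := by
  obtain ⟨K, hK, horth⟩ := CVA.exists_eventually_nearOrthonormal m k hk
  -- k + 1 is the number of columns; the added 1 only makes the constant positive when K = 0.
  refine ⟨4 * ((k + 1) * K) + 1, by positivity, fun t ht => ?_⟩
  refine CVA.eventually_smallRoundoff (P := fun p =>
    CVA.flNorm p.2 (CVA.startVec m) ≠ 0 ∧
      (∀ j < k, CVA.arnoldiSubdiag p.2 (CVA.confluentOp t) (CVA.startVec m) j ≠ 0) ∧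
      LinearIndependent ℝ (CVA.arnoldiBasis p.2 (CVA.confluentOp t) (CVA.startVec m) k).col ∧
      |CVA.cond₂ (CVA.arnoldiBasis p.2 (CVA.confluentOp t) (CVA.startVec m) k) - 1| ≤
        (4 * ((k + 1) * K) + 1) * p.1).1 ?_
  have hb := CVA.startVec_ne_zero (by omega : 0 < m)
  -- Each computed normalization factor tends to a nonzero exact one, and there are finitely many.
  have hsub : ∀ᶠ p in CVA.smallRoundoff, ∀ j ∈ Set.Iio k,
      CVA.arnoldiSubdiag p.2 (CVA.confluentOp t) (CVA.startVec m) j ≠ 0 := by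
    refine (Filter.eventually_all_finite (Set.finite_Iio k)).2 fun j hj => ?_
    have hj' : j < k := hj
    have h0 := CVA.arnoldiNext_exact_ne_zero ht (by omega : j + 1 < 2 * m)
    simp only [CVA.arnoldiSubdiag_eq]
    exact (CVA.tendsto_flNorm (CVA.tendsto_arnoldiNext ht (by omega)) h0).eventually_ne
      (CVA.flNorm_exact_ne_zero h0)
  filter_upwards [CVA.eventually_nonneg, horth t ht, hsub,
    CVA.eventually_mul_le ((k + 1) * K) (by norm_num : (0 : ℝ) < 1 / 2),
    (CVA.tendsto_flNorm tendsto_const_nhds hb).eventually_ne (CVA.flNorm_exact_ne_zero hb)]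
    with p h0 hv hs hKp hb'
  have hgram : ∀ i j, |((CVA.arnoldiBasis p.2 (CVA.confluentOp t) (CVA.startVec m) k).transpose *
      CVA.arnoldiBasis p.2 (CVA.confluentOp t) (CVA.startVec m) k) i j -
        (1 : Matrix (Fin (k + 1)) (Fin (k + 1)) ℝ) i j| ≤ K * p.1 := by
    intro i j
    have h := hv i.1 i.2 j.1 j.2
    simp only [Matrix.one_apply, Fin.ext_iff]
    exact h
  refine ⟨hb', hs, CVA.linearIndependent_col_of_nearOrthonormal hgram ?_,
    (CVA.abs_cond₂_sub_one_le hgram ?_).trans ?_⟩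
  all_goals
    rw [Fintype.card_fin]
    push_cast
    linarith
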